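/- For a bounded open set $\Omega\subset\mathbb R^2$ let $H_0^1(\Omega)$, $H_0^2(\Omega)$ be the closures of $C_c^\infty(\Omega;\mathbb R)$ in $H^1(\Omega)$, $H^2(\Omega)$, and let the Poincaré constant $C_P(\Omega)$ be the least $k\ge 0$ such that $\int_\Omega |v|^2\le k^2\int_\Omega|\nabla v|^2$ for all $v\in H_0^1(\Omega)$. For every $C'\ge 1$ there exists $C>0$, depending only on $C'$, such that the following holds for every $\varepsilon>0$, every bounded open set $\Omega\subset\mathbb R^2$ with $C_P(\Omega)^2\le (C')^2\varepsilon^2$, every $s\ge 1$ and every $\varphi\in C^\infty(\Omega;\mathbb R)$ with $-\Delta\varphi\ge s$ in $\Omega$. Let $u\in H_0^2(\Omega;\mathbb R)$, and suppose that the weight $e^{-\varphi}$ is bounded on $U\cap\Omega$ for some open set $U\subset\mathbb R^2$ containing the support of $u$ (the closure in $\mathbb R^2$ of $\{x\in\Omega: u(x)\neq 0\}$); this holds for every $u\in H_0^2(\Omega;\mathbb R)$ if $\varphi$ is bounded below on $\Omega$, for instance if $\varphi\in C^\infty(\overline\Omega)$, and for every $\varphi$ if $u$ has compact support in $\Omega$,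 for instance if $u\in C_c^\infty(\Omega;\mathbb R)$. Then $$\varepsilon^{-4}\int_\Omega e^{-\varphi}|u|^2+s^2\int_\Omega e^{-\varphi}|u|^2+\varepsilon^{-2}\int_\Omega e^{-\varphi}|\nabla u|^2+s\int_\Omega e^{-\varphi}|\nabla u|^2\le C\int_\Omega e^{-\varphi}|\Delta u|^2 .$$ -/

import Mathlib

open MeasureTheory Filter Topology
open scoped ENNReal ContDiff Distributions

/-- The Euclidean plane `ℝ²`. -/
abbrev Plane : Type := EuclideanSpace ℝ (Fin 2)

/-- The classical partial derivative `∂ᵢ f`. -/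
noncomputable def partialDeriv (i : Fin 2) (f : Plane → ℝ) (x : Plane) : ℝ :=
  fderiv ℝ f x (EuclideanSpace.single i 1)

/-- `g` is the weak partial derivative `∂ᵢ u` in the open set `Ω`: both are locally integrable
in `Ω` and `∫_Ω u ∂ᵢψ = - ∫_Ω g ψ` for every `ψ ∈ C_c^∞(Ω)`. -/
def HasWeakPartial (Ω : TopologicalSpace.Opens Plane) (i : Fin 2) (u g : Plane → ℝ) : Prop :=
  LocallyIntegrableOn u (Ω : Set Plane) ∧ LocallyIntegrableOn g (Ω : Set Plane) ∧
    ∀ ψ : 𝓓(Ω, ℝ),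
      ∫ x in (Ω : Set Plane), u x * partialDeriv i ψ x = -∫ x in (Ω : Set Plane), g x * ψ x

/-- Convergence `f n → g` in `L²(Ω)`. -/
def TendstoL2 (Ω : TopologicalSpace.Opens Plane) (f : ℕ → Plane → ℝ) (g : Plane → ℝ) : Prop :=
  Tendsto (fun n => eLpNorm (f n - g) 2 (volume.restrict (Ω : Set Plane))) atTop (𝓝 0)

/-- `u` belongs to `H₀¹(Ω)`, the closure of `C_c^∞(Ω)` in `H¹(Ω)`, and its weak gradient is
`p = (p 0, p 1)`. -/
structure IsH10 (Ω : TopologicalSpace.Opens Plane) (u : Plane → ℝ) (p : Fin 2 → Plane → ℝ) :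
    Prop where
  memLp : MemLp u 2 (volume.restrict (Ω : Set Plane))
  memLp_grad : ∀ i, MemLp (p i) 2 (volume.restrict (Ω : Set Plane))
  weak_grad : ∀ i, HasWeakPartial Ω i u (p i)
  approx : ∃ ψ : ℕ → 𝓓(Ω, ℝ),
    TendstoL2 Ω (fun n => ψ n) u ∧ ∀ i, TendstoL2 Ω (fun n => partialDeriv i (ψ n)) (p i)

/-- `u` belongs to `H₀²(Ω)`, the closure of `C_c^∞(Ω)` in `H²(Ω)`, its weak gradient is
`p = (p 0, p 1)`, and its weak second derivatives are `q i j = ∂ᵢ ∂ⱼ u`. -/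
structure IsH20 (Ω : TopologicalSpace.Opens Plane) (u : Plane → ℝ) (p : Fin 2 → Plane → ℝ)
    (q : Fin 2 → Fin 2 → Plane → ℝ) : Prop where
  memLp : MemLp u 2 (volume.restrict (Ω : Set Plane))
  memLp_grad : ∀ i, MemLp (p i) 2 (volume.restrict (Ω : Set Plane))
  memLp_hess : ∀ i j, MemLp (q i j) 2 (volume.restrict (Ω : Set Plane))
  weak_grad : ∀ i, HasWeakPartial Ω i u (p i)
  weak_hess : ∀ i j, HasWeakPartial Ω i (p j) (q i j)
  approx : ∃ ψ : ℕ → 𝓓(Ω, ℝ),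
    TendstoL2 Ω (fun n => ψ n) u ∧
    (∀ i, TendstoL2 Ω (fun n => partialDeriv i (ψ n)) (p i)) ∧
    ∀ i j, TendstoL2 Ω (fun n => partialDeriv i (partialDeriv j (ψ n))) (q i j)

/-- The Poincaré constant `C_P(Ω)`: the least `k` such that
`∫_Ω |u|² ≤ k² ∫_Ω |∇u|²` for every `u ∈ H₀¹(Ω)`. -/
noncomputable def poincareConstant (Ω : TopologicalSpace.Opens Plane) : ℝ≥0∞ :=
  sInf {k : ℝ≥0∞ | ∀ (u : Plane → ℝ) (p : Fin 2 → Plane → ℝ), IsH10 Ω u p →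
    ∫⁻ x in (Ω : Set Plane), ‖u x‖ₑ ^ 2 ≤
      k ^ 2 * ∫⁻ x in (Ω : Set Plane), ∑ i, ‖p i x‖ₑ ^ 2}

/-- The weighted integral `∫_Ω e^{-φ} f`, with values in `[0, ∞]`, of a nonnegative function `f`. -/
noncomputable def weightedIntegral (Ω : TopologicalSpace.Opens Plane) (φ f : Plane → ℝ) : ℝ≥0∞ :=
  ∫⁻ x in (Ω : Set Plane), ENNReal.ofReal (Real.exp (-φ x) * f x)

/-! The estimate is a Bochner–Hörmander argument for `2∂_z = ∂₀ - i∂₁`. For a compactly supported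
smooth field `F = f + i g`, the real and imaginary parts of `2∂_z F` are `div F` and `curl F`. With
`w = e^{-φ/2} F` and `A = (-∂₁φ, ∂₀φ)/2`, whose curl is `Δφ/2`, completing squares gives `∫ e^{-φ}
(|div F|² + |curl F|²) = ∫ |∇_A w|² + ½ ∫ (-Δφ) e^{-φ} |F|²` (`integral_divCurlEnergy_eq`). Both
terms on the right are nonnegative. The second is at least `s/2 ∫ e^{-φ} |F|²`. The first controls
`∫ |w|²` through the diamagnetic inequality `|∇|w|| ≤ |∇_A w|` and the Poincaré inequality for
`|w|`. Hence `∫ e^{-φ} |F|²` is at most `c` times the left side, both for `c = 2/s` and for `c = κ²`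
with `κ > C_P(Ω)` (`weightedIntegral_sq_add_sq_le`). For a test function `ψ`, the field `(ψ, 0)` has
`|div|² + |curl|² = |∇ψ|²`, and `∇ψ` has divergence `Δψ` and curl `0`. Chaining the two cases bounds
`ψ` and `∇ψ` by `Δψ` in the weighted norms. For `u` in `H₀²`, the approximating test functions need
not converge in the weighted norm, since `e^{-φ}` is bounded only near the support of `u`.
Multiplying them by a cutoff equal to `1` near that support repairs this
(`IsH20.exists_weightedTendsto`). -/

/-! ### Calculus of partial derivatives. -/

theorem ContDiff.partialDeriv {f : Plane → ℝ} (hf : ContDiff ℝ ∞ f) (i : Fin 2) :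
    ContDiff ℝ ∞ (partialDeriv i f) :=
  (hf.fderiv_right (m := ∞) le_rfl).clm_apply contDiff_const

theorem HasCompactSupport.partialDeriv {f : Plane → ℝ} (hf : HasCompactSupport f) (i : Fin 2) :
    HasCompactSupport (partialDeriv i f) :=
  hf.fderiv_apply ℝ _

theorem tsupport_partialDeriv_subset (i : Fin 2) (f : Plane → ℝ) :
    tsupport (partialDeriv i f) ⊆ tsupport f :=
  tsupport_fderiv_apply_subset ℝ _

theorem Filter.EventuallyEq.partialDeriv {f g : Plane → ℝ} {x : Plane} (h : f =ᶠ[𝓝 x] g)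
    (i : Fin 2) : partialDeriv i f =ᶠ[𝓝 x] partialDeriv i g := by
  filter_upwards [h.fderiv (𝕜 := ℝ)] with y hy
  simp only [_root_.partialDeriv, hy]

section Rules

variable {f g : Plane → ℝ} {x : Plane} (i : Fin 2)

theorem partialDeriv_add (hf : DifferentiableAt ℝ f x) (hg : DifferentiableAt ℝ g x) :
    partialDeriv i (fun y => f y + g y) x = partialDeriv i f x + partialDeriv i g x := by
  simp [partialDeriv, fderiv_fun_add hf hg]

theorem partialDeriv_const_mul (c : ℝ) (hf : DifferentiableAt ℝ f x) :
    partialDeriv i (fun y => c * f y) x = c * partialDeriv i f x := by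
  simp [partialDeriv, fderiv_const_mul hf]

theorem partialDeriv_mul (hf : DifferentiableAt ℝ f x) (hg : DifferentiableAt ℝ g x) :
    partialDeriv i (fun y => f y * g y) x =
      partialDeriv i f x * g x + f x * partialDeriv i g x := by
  simp [partialDeriv, fderiv_fun_mul hf hg]; ring

theorem partialDeriv_sq (hf : DifferentiableAt ℝ f x) :
    partialDeriv i (fun y => f y ^ 2) x = 2 * f x * partialDeriv i f x := by
  simp only [pow_two, partialDeriv_mul i hf hf]; ring

theorem partialDeriv_sub_const (c : ℝ) :
    partialDeriv i (fun y => f y - c) x = partialDeriv i f x := by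
  simp [partialDeriv, fderiv_sub_const]

theorem partialDeriv_add_const (c : ℝ) :
    partialDeriv i (fun y => f y + c) x = partialDeriv i f x := by
  simp [partialDeriv, fderiv_add_const]

theorem partialDeriv_exp (hf : DifferentiableAt ℝ f x) :
    partialDeriv i (fun y => Real.exp (f y)) x = Real.exp (f x) * partialDeriv i f x := by
  simp [partialDeriv, fderiv_exp hf]

theorem partialDeriv_sqrt (hf : DifferentiableAt ℝ f x) (h0 : f x ≠ 0) :
    partialDeriv i (fun y => √(f y)) x = partialDeriv i f x / (2 * √(f x)) := by
  simp [partialDeriv, fderiv_sqrt hf h0]; ring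

end Rules

theorem partialDeriv_comm {f : Plane → ℝ} (hf : ContDiff ℝ ∞ f) (i j : Fin 2) (x : Plane) :
    partialDeriv i (partialDeriv j f) x = partialDeriv j (partialDeriv i f) x := by
  have hd : DifferentiableAt ℝ (fderiv ℝ f) x :=
    (hf.fderiv_right (m := ∞) le_rfl).differentiable (by simp) x
  have key : ∀ v w : Plane, fderiv ℝ (fun y => fderiv ℝ f y v) x w = fderiv ℝ (fderiv ℝ f) x w v := by
    intro v w
    rw [fderiv_clm_apply hd (differentiableAt_const v)]
    simp
  have hs : IsSymmSndFDerivAt ℝ f x := (contDiff_infty.1 hf 2).contDiffAt.isSymmSndFDerivAt (by simp)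
  unfold partialDeriv
  rw [key, key]
  exact hs _ _

theorem laplacian_eq_sum_partialDeriv {f : Plane → ℝ} (hf : ContDiff ℝ ∞ f) (x : Plane) :
    Laplacian.laplacian f x = ∑ i, partialDeriv i (partialDeriv i f) x := by
  have hd : DifferentiableAt ℝ (fderiv ℝ f) x :=
    (hf.fderiv_right (m := ∞) le_rfl).differentiable (by simp) x
  rw [InnerProductSpace.laplacian_eq_iteratedFDeriv_orthonormalBasis f
    (EuclideanSpace.basisFun (Fin 2) ℝ)]
  refine Finset.sum_congr rfl fun i _ => ?_
  unfold partialDeriv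
  rw [iteratedFDeriv_two_apply, fderiv_clm_apply hd (differentiableAt_const _)]
  simp

/-! ### Integration by parts and cutoffs. -/

theorem ContDiff.integrable_of_hasCompactSupport {f : Plane → ℝ} (hf : ContDiff ℝ ∞ f)
    (hc : HasCompactSupport f) : Integrable f :=
  hf.continuous.integrable_of_hasCompactSupport hc

theorem integral_mul_partialDeriv {f g : Plane → ℝ} (hf : ContDiff ℝ ∞ f)
    (hg : ContDiff ℝ ∞ g) (hc : HasCompactSupport g) (i : Fin 2) :
    ∫ x, f x * partialDeriv i g x = -∫ x, partialDeriv i f x * g x := by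
  refine integral_mul_fderiv_eq_neg_fderiv_mul_of_integrable ?_ ?_ ?_ ?_ ?_
  · exact ((hf.partialDeriv i).mul hg).integrable_of_hasCompactSupport hc.mul_left
  · exact (hf.mul (hg.partialDeriv i)).integrable_of_hasCompactSupport (hc.partialDeriv i).mul_left
  · exact (hf.mul hg).integrable_of_hasCompactSupport hc.mul_left
  · exact fun x _ => hf.differentiable (by simp) x
  · exact fun x _ => hg.differentiable (by simp) x

theorem integral_partialDeriv_eq_zero {g : Plane → ℝ}
    (hg : ContDiff ℝ ∞ g) (hc : HasCompactSupport g) (i : Fin 2) :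
    ∫ x, partialDeriv i g x = 0 := by
  have := integral_mul_partialDeriv (f := fun _ => 1) contDiff_const hg hc i
  simpa [partialDeriv] using this

/-- A smooth cutoff equal to `1` near a compact set and supported in a given neighbourhood. -/
theorem exists_contDiff_cutoff {K U : Set Plane} (hK : IsCompact K) (hU : IsOpen U) (h : K ⊆ U) :
    ∃ χ : Plane → ℝ, ContDiff ℝ ∞ χ ∧ HasCompactSupport χ ∧ tsupport χ ⊆ U ∧
      ∀ x ∈ K, χ =ᶠ[𝓝 x] fun _ => 1 := by
  obtain ⟨L, hL, hKL, hLU⟩ := exists_compact_between hK hU h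
  obtain ⟨f, h1, h0, -⟩ := exists_contMDiffMap_one_nhds_of_subset_interior
    (modelWithCornersSelf ℝ Plane) (n := ⊤) hK.isClosed hKL
  have hsub : tsupport f ⊆ L :=
    closure_minimal (fun x hx => by_contra fun hxL => hx (h0 x hxL)) hL.isClosed
  refine ⟨f, f.contMDiff.contDiff, hL.of_isClosed_subset (isClosed_tsupport _) hsub,
    hsub.trans hLU, fun x hx => ?_⟩
  exact h1.filter_mono (nhds_le_nhdsSet hx)

/-! ### The magnetic identity and the diamagnetic inequality. -/

/-- The density `|∇_A w|²` of the magnetic energy of `w = e^{-φ/2} (f + i g)`, where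
`A = (-∂₁φ, ∂₀φ) / 2`. -/
noncomputable def magneticEnergy (φ f g : Plane → ℝ) (x : Plane) : ℝ :=
  Real.exp (-φ x) *
    ((partialDeriv 0 f x - partialDeriv 0 φ x / 2 * f x + partialDeriv 1 φ x / 2 * g x) ^ 2 +
      (partialDeriv 0 g x - partialDeriv 0 φ x / 2 * g x - partialDeriv 1 φ x / 2 * f x) ^ 2 +
      ((partialDeriv 1 f x - partialDeriv 1 φ x / 2 * f x - partialDeriv 0 φ x / 2 * g x) ^ 2 +
      (partialDeriv 1 g x - partialDeriv 1 φ x / 2 * g x + partialDeriv 0 φ x / 2 * f x) ^ 2))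

/-- The weighted density `e^{-φ} (|div F|² + |curl F|²)` of the vector field `F = (f, g)`. -/
noncomputable def divCurlEnergy (φ f g : Plane → ℝ) (x : Plane) : ℝ :=
  Real.exp (-φ x) * ((partialDeriv 0 f x + partialDeriv 1 g x) ^ 2 +
    (partialDeriv 0 g x - partialDeriv 1 f x) ^ 2)

section Smooth

variable {φ f g : Plane → ℝ} (hφ : ContDiff ℝ ∞ φ) (hf : ContDiff ℝ ∞ f) (hg : ContDiff ℝ ∞ g)

theorem magneticEnergy_nonneg (φ f g : Plane → ℝ) (x : Plane) : 0 ≤ magneticEnergy φ f g x := by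
  unfold magneticEnergy; positivity

include hφ hf hg in
theorem contDiff_magneticEnergy : ContDiff ℝ ∞ (magneticEnergy φ f g) := by
  have := hφ.partialDeriv 0; have := hφ.partialDeriv 1
  have := hf.partialDeriv 0; have := hf.partialDeriv 1
  have := hg.partialDeriv 0; have := hg.partialDeriv 1
  unfold magneticEnergy; fun_prop

theorem partialDeriv_eq_zero_of_notMem_tsupport {x : Plane} (hx : x ∉ tsupport f) (i : Fin 2) :
    partialDeriv i f x = 0 :=
  image_eq_zero_of_notMem_tsupport fun h => hx (tsupport_partialDeriv_subset i f h)

theorem magneticEnergy_eq_zero (φ : Plane → ℝ) {x : Plane} (hx : x ∉ tsupport f ∪ tsupport g) :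
    magneticEnergy φ f g x = 0 := by
  rw [Set.mem_union, not_or] at hx
  simp [magneticEnergy, partialDeriv_eq_zero_of_notMem_tsupport hx.1,
    partialDeriv_eq_zero_of_notMem_tsupport hx.2, image_eq_zero_of_notMem_tsupport hx.1,
    image_eq_zero_of_notMem_tsupport hx.2]

include hφ hf hg in
-- Pointwise form of the identity: the two derivative terms are exact divergences of fields that
-- vanish with `f` and `g`, so only the magnetic energy and the curvature term `-Δφ/2` survive
-- integration.
theorem divCurlEnergy_eq (x : Plane) :
    divCurlEnergy φ f g x = magneticEnergy φ f g x +
      partialDeriv 0 (fun y => Real.exp (-1 * φ y) * (2 * (f y * partialDeriv 1 g y) +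
        (-1) * (partialDeriv 1 φ y * (f y * g y)) +
        (1 / 2) * (partialDeriv 0 φ y * (f y ^ 2 + g y ^ 2)))) x +
      partialDeriv 1 (fun y => Real.exp (-1 * φ y) * ((-2) * (f y * partialDeriv 0 g y) +
        partialDeriv 0 φ y * (f y * g y) +
        (1 / 2) * (partialDeriv 1 φ y * (f y ^ 2 + g y ^ 2)))) x +
      1 / 2 * (-(∑ i, partialDeriv i (partialDeriv i φ) x) *
        (Real.exp (-φ x) * (f x ^ 2 + g x ^ 2))) := by
  have h1 := hφ.differentiable (by simp)
  have h2 := hf.differentiable (by simp)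
  have h3 := hg.differentiable (by simp)
  have h4 := (hφ.partialDeriv 0).differentiable (by simp)
  have h5 := (hφ.partialDeriv 1).differentiable (by simp)
  have h6 := (hg.partialDeriv 0).differentiable (by simp)
  have h7 := (hg.partialDeriv 1).differentiable (by simp)
  rw [partialDeriv_mul _ (by fun_prop) (by fun_prop), partialDeriv_mul _ (by fun_prop) (by fun_prop),
    partialDeriv_exp _ (by fun_prop), partialDeriv_exp _ (by fun_prop),
    partialDeriv_const_mul _ _ (by fun_prop), partialDeriv_const_mul _ _ (by fun_prop),
    partialDeriv_add _ (by fun_prop) (by fun_prop), partialDeriv_add _ (by fun_prop) (by fun_prop),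
    partialDeriv_add _ (by fun_prop) (by fun_prop), partialDeriv_add _ (by fun_prop) (by fun_prop)]
  simp (disch := fun_prop) only [partialDeriv_const_mul, partialDeriv_mul, partialDeriv_add,
    partialDeriv_sq]
  -- By symmetry, the mixed second derivatives of `g` and `φ` coming from the two fluxes cancel; the
  -- pure second derivatives of `φ` cancel against the curvature term.
  rw [partialDeriv_comm hg 1 0, partialDeriv_comm hφ 1 0, Fin.sum_univ_two]
  unfold divCurlEnergy magneticEnergy
  rw [show -1 * φ x = -φ x by ring]
  ring

variable (hfc : HasCompactSupport f) (hgc : HasCompactSupport g)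

theorem integrable_sq_of_hasCompactSupport {h : Plane → ℝ} (hc : Continuous h)
    (hs : HasCompactSupport h) : Integrable fun x => h x ^ 2 := by
  have : (fun x => h x ^ 2) = h * h := funext fun x => pow_two _
  rw [this]
  exact (hc.mul hc).integrable_of_hasCompactSupport hs.mul_left

theorem hasCompactSupport_of_eq_zero_off {h : Plane → ℝ} (hfc : HasCompactSupport f)
    (hgc : HasCompactSupport g) (hz : ∀ x ∉ tsupport f ∪ tsupport g, h x = 0) :
    HasCompactSupport h :=
  HasCompactSupport.intro (IsCompact.union hfc hgc) (fun {x} hx => hz x hx)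

include hφ hf hg hfc hgc in
theorem integral_divCurlEnergy_eq :
    ∫ x, divCurlEnergy φ f g x = (∫ x, magneticEnergy φ f g x) +
      1 / 2 * ∫ x, -(∑ i, partialDeriv i (partialDeriv i φ) x) *
        (Real.exp (-φ x) * (f x ^ 2 + g x ^ 2)) := by
  have h4 := hφ.partialDeriv 0
  have h5 := hφ.partialDeriv 1
  have h6 := hg.partialDeriv 0
  have h7 := hg.partialDeriv 1
  have h8 := h4.partialDeriv 0
  have h9 := h5.partialDeriv 1
  have hz : ∀ x ∉ tsupport f ∪ tsupport g, f x = 0 ∧ g x = 0 := fun x hx => by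
    rw [Set.mem_union, not_or] at hx
    exact ⟨image_eq_zero_of_notMem_tsupport hx.1, image_eq_zero_of_notMem_tsupport hx.2⟩
  have key : ∀ {h : Plane → ℝ}, (∀ x, f x = 0 → g x = 0 → h x = 0) → HasCompactSupport h :=
    fun hh => hasCompactSupport_of_eq_zero_off hfc hgc fun x hx => hh x (hz x hx).1 (hz x hx).2
  simp_rw [divCurlEnergy_eq hφ hf hg]
  have i1 : Integrable (magneticEnergy φ f g) :=
    (contDiff_magneticEnergy hφ hf hg).integrable_of_hasCompactSupport
      (hasCompactSupport_of_eq_zero_off hfc hgc fun x hx => magneticEnergy_eq_zero φ hx)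
  rw [integral_add, integral_add, integral_add, integral_partialDeriv_eq_zero,
    integral_partialDeriv_eq_zero, integral_const_mul]
  · ring
  · fun_prop
  · exact key fun x h h' => by simp [h, h']
  · fun_prop
  · exact key fun x h h' => by simp [h, h']
  · exact i1
  · refine (ContDiff.partialDeriv ?_ _).integrable_of_hasCompactSupport
      (HasCompactSupport.partialDeriv ?_ _)
    · fun_prop
    · exact key fun x h h' => by simp [h, h']
  · refine i1.add ((ContDiff.partialDeriv ?_ _).integrable_of_hasCompactSupport
      (HasCompactSupport.partialDeriv ?_ _))
    · fun_prop
    · exact key fun x h h' => by simp [h, h']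
  · refine (ContDiff.partialDeriv ?_ _).integrable_of_hasCompactSupport
      (HasCompactSupport.partialDeriv ?_ _)
    · fun_prop
    · exact key fun x h h' => by simp [h, h']
  · refine (i1.add ((ContDiff.partialDeriv ?_ _).integrable_of_hasCompactSupport
      (HasCompactSupport.partialDeriv ?_ _))).add ((ContDiff.partialDeriv ?_ _).integrable_of_hasCompactSupport
      (HasCompactSupport.partialDeriv ?_ _))
    · fun_prop
    · exact key fun x h h' => by simp [h, h']
    · fun_prop
    · exact key fun x h h' => by simp [h, h']
  · refine ContDiff.integrable_of_hasCompactSupport ?_ ?_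
    · simp only [Fin.sum_univ_two]; fun_prop
    · exact key fun x h h' => by simp [h, h']

include hφ hf hg hfc hgc in
theorem mul_integral_le_integral_divCurlEnergy {s : ℝ}
    (hs : ∀ x ∈ tsupport f ∪ tsupport g, s ≤ -∑ i, partialDeriv i (partialDeriv i φ) x) :
    s / 2 * ∫ x, Real.exp (-φ x) * (f x ^ 2 + g x ^ 2) ≤ ∫ x, divCurlEnergy φ f g x := by
  rw [integral_divCurlEnergy_eq hφ hf hg hfc hgc]
  have h1 : 0 ≤ ∫ x, magneticEnergy φ f g x := integral_nonneg (magneticEnergy_nonneg φ f g)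
  have h4 := (hφ.partialDeriv 0).partialDeriv 0
  have h5 := (hφ.partialDeriv 1).partialDeriv 1
  have hz : ∀ x ∉ tsupport f ∪ tsupport g, f x = 0 ∧ g x = 0 := fun x hx => by
    rw [Set.mem_union, not_or] at hx
    exact ⟨image_eq_zero_of_notMem_tsupport hx.1, image_eq_zero_of_notMem_tsupport hx.2⟩
  have h2 : ∫ x, s * (Real.exp (-φ x) * (f x ^ 2 + g x ^ 2)) ≤
      ∫ x, -(∑ i, partialDeriv i (partialDeriv i φ) x) *
        (Real.exp (-φ x) * (f x ^ 2 + g x ^ 2)) := by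
    refine integral_mono ?_ ?_ fun x => ?_
    · refine ContDiff.integrable_of_hasCompactSupport (by fun_prop)
        (hasCompactSupport_of_eq_zero_off hfc hgc fun x hx => ?_)
      simp [hz x hx]
    · refine ContDiff.integrable_of_hasCompactSupport ?_
        (hasCompactSupport_of_eq_zero_off hfc hgc fun x hx => ?_)
      · simp only [Fin.sum_univ_two]; fun_prop
      · simp [hz x hx]
    · by_cases hx : x ∈ tsupport f ∪ tsupport g
      · exact mul_le_mul_of_nonneg_right (hs x hx) (by positivity)
      · simp [hz x hx]
  rw [integral_const_mul] at h2
  linarith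

include hφ hf hg in
/-- The diamagnetic inequality for the regularised modulus of `e^{-φ/2} (f + i g)`. -/
theorem sum_sq_partialDeriv_regularised_le {δ : ℝ} (hδ : 0 < δ) (x : Plane) :
    ∑ i, partialDeriv i (fun y => √(Real.exp (-1 * φ y) * (f y ^ 2 + g y ^ 2) + δ ^ 2) - δ) x ^ 2 ≤
      magneticEnergy φ f g x := by
  have h1 := hφ.differentiable (by simp)
  have h2 := hf.differentiable (by simp)
  have h3 := hg.differentiable (by simp)
  have hpos : 0 < Real.exp (-1 * φ x) * (f x ^ 2 + g x ^ 2) + δ ^ 2 := by positivity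
  have hd : ∀ i, partialDeriv i
      (fun y => √(Real.exp (-1 * φ y) * (f y ^ 2 + g y ^ 2) + δ ^ 2) - δ) x =
      Real.exp (-φ x) * (f x * (partialDeriv i f x) + g x * partialDeriv i g x -
        partialDeriv i φ x / 2 * (f x ^ 2 + g x ^ 2)) /
        √(Real.exp (-φ x) * (f x ^ 2 + g x ^ 2) + δ ^ 2) := by
    intro i
    rw [partialDeriv_sub_const, partialDeriv_sqrt _ (by fun_prop) hpos.ne', partialDeriv_add_const,
      partialDeriv_mul _ (by fun_prop) (by fun_prop), partialDeriv_exp _ (by fun_prop),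
      partialDeriv_const_mul _ _ (by fun_prop), partialDeriv_add _ (by fun_prop) (by fun_prop),
      partialDeriv_sq _ (by fun_prop), partialDeriv_sq _ (by fun_prop),
      show -1 * φ x = -φ x by ring]
    have : √(Real.exp (-φ x) * (f x ^ 2 + g x ^ 2) + δ ^ 2) ≠ 0 := by positivity
    field_simp
    ring
  have key : ∀ a b A B W : ℝ, 0 ≤ W →
      (W * (a * A + b * B) / √(W * (a ^ 2 + b ^ 2) + δ ^ 2)) ^ 2 ≤ W * (A ^ 2 + B ^ 2) := by
    intro a b A B W hW
    rw [div_pow, Real.sq_sqrt (by positivity), div_le_iff₀ (by positivity)]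
    -- The difference of the two sides is exactly the sum of these two terms: the Lagrange defect of
    -- Cauchy–Schwarz and the contribution of `δ²`.
    have e1 : 0 ≤ W ^ 2 * (a * B - b * A) ^ 2 := by positivity
    have e2 : 0 ≤ W * (A ^ 2 + B ^ 2) * δ ^ 2 := by positivity
    nlinarith
  rw [Fin.sum_univ_two, hd, hd]
  have k0 := key (f x) (g x)
    (partialDeriv 0 f x - partialDeriv 0 φ x / 2 * f x + partialDeriv 1 φ x / 2 * g x)
    (partialDeriv 0 g x - partialDeriv 0 φ x / 2 * g x - partialDeriv 1 φ x / 2 * f x)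
    (Real.exp (-φ x)) (Real.exp_pos _).le
  have k1 := key (f x) (g x)
    (partialDeriv 1 f x - partialDeriv 1 φ x / 2 * f x - partialDeriv 0 φ x / 2 * g x)
    (partialDeriv 1 g x - partialDeriv 1 φ x / 2 * g x + partialDeriv 0 φ x / 2 * f x)
    (Real.exp (-φ x)) (Real.exp_pos _).le
  unfold magneticEnergy
  -- The terms with `A` drop out of `f * (real part) + g * (imaginary part)`, because `i A w` is
  -- orthogonal to `w`.
  refine le_trans (le_of_eq ?_) ((add_le_add k0 k1).trans_eq (mul_add _ _ _).symm)
  congr 4 <;> ring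

include hφ hf hg hfc hgc in
-- Poincaré applied to `|w|`. The modulus is not smooth at its zeros, so it is regularised with a
-- parameter `δ` that then tends to `0`.
theorem integral_le_mul_integral_magneticEnergy {Ω : Set Plane}
    (hfΩ : tsupport f ⊆ Ω) (hgΩ : tsupport g ⊆ Ω) {K : ℝ} (hK : 0 ≤ K)
    (hP : ∀ h : Plane → ℝ, ContDiff ℝ ∞ h → HasCompactSupport h → tsupport h ⊆ Ω →
      ∫ x, h x ^ 2 ≤ K * ∫ x, ∑ i, partialDeriv i h x ^ 2) :
    ∫ x, Real.exp (-φ x) * (f x ^ 2 + g x ^ 2) ≤ K * ∫ x, magneticEnergy φ f g x := by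
  have hz : ∀ x ∉ tsupport f ∪ tsupport g, f x = 0 ∧ g x = 0 := fun x hx => by
    rw [Set.mem_union, not_or] at hx
    exact ⟨image_eq_zero_of_notMem_tsupport hx.1, image_eq_zero_of_notMem_tsupport hx.2⟩
  set r : Plane → ℝ := fun x => √(Real.exp (-φ x) * (f x ^ 2 + g x ^ 2)) with hr
  have hrc : HasCompactSupport r :=
    hasCompactSupport_of_eq_zero_off hfc hgc fun x hx => by simp [hr, hz x hx]
  have hr1 : Continuous r := by
    have := hφ.continuous; have := hf.continuous; have := hg.continuous
    fun_prop
  have hri : Integrable r := hr1.integrable_of_hasCompactSupport hrc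
  have hr2 : ∀ x, r x ^ 2 = Real.exp (-φ x) * (f x ^ 2 + g x ^ 2) :=
    fun x => Real.sq_sqrt (by positivity)
  have hr2i : Integrable (fun x => r x ^ 2) :=
    integrable_sq_of_hasCompactSupport hr1 hrc
  simp_rw [← hr2]
  have main : ∀ δ : ℝ, 0 < δ →
      ∫ x, r x ^ 2 ≤ K * (∫ x, magneticEnergy φ f g x) + 2 * δ * ∫ x, r x := by
    intro δ hδ
    -- Adding `δ²` under the root makes `h` smooth; subtracting `δ` makes it vanish where `f` and
    -- `g` do, so that `hP` applies.
    set h : Plane → ℝ :=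
      fun y => √(Real.exp (-1 * φ y) * (f y ^ 2 + g y ^ 2) + δ ^ 2) - δ with hh
    have hh0 : ∀ x ∉ tsupport f ∪ tsupport g, h x = 0 := fun x hx => by
      simp [hh, hz x hx, Real.sqrt_sq hδ.le]
    have hcd : ContDiff ℝ ∞ h := by
      refine ContDiff.sub (ContDiff.sqrt (by fun_prop) fun x => ?_) contDiff_const
      positivity
    have hcs : HasCompactSupport h := hasCompactSupport_of_eq_zero_off hfc hgc hh0
    have hts : tsupport h ⊆ Ω := by
      refine (closure_minimal (fun x hx => ?_) (hfc.isCompact.union hgc.isCompact).isClosed).trans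
        (Set.union_subset hfΩ hgΩ)
      by_contra hx'
      exact hx (hh0 x hx')
    have hPh := hP h hcd hcs hts
    have e1 : ∫ x, ∑ i, partialDeriv i h x ^ 2 ≤ ∫ x, magneticEnergy φ f g x := by
      refine integral_mono_of_nonneg (ae_of_all _ fun x => ?_) ?_
        (ae_of_all _ fun x => sum_sq_partialDeriv_regularised_le hφ hf hg hδ x)
      · exact Finset.sum_nonneg fun i _ => sq_nonneg _
      · exact (contDiff_magneticEnergy hφ hf hg).integrable_of_hasCompactSupport
          (hasCompactSupport_of_eq_zero_off hfc hgc fun x hx => magneticEnergy_eq_zero φ hx)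
    -- From `(h + δ)² = r² + δ²` follow `r² = h² + 2δh` and `h ≤ r`.
    have e2 : ∫ x, r x ^ 2 ≤ ∫ x, (h x ^ 2 + 2 * δ * r x) := by
      refine integral_mono hr2i (Integrable.add ?_ (hri.const_mul _)) fun x => ?_
      · exact integrable_sq_of_hasCompactSupport hcd.continuous hcs
      · have hr0 : 0 ≤ r x := Real.sqrt_nonneg _
        have q1 : (h x + δ) ^ 2 = r x ^ 2 + δ ^ 2 := by
          simp only [hh, sub_add_cancel, hr2]
          rw [Real.sq_sqrt (by positivity), show -1 * φ x = -φ x by ring]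
        have q2 : h x ≤ r x := by
          have : h x + δ ≤ r x + δ := by
            refine abs_le_of_sq_le_sq' ?_ (by positivity) |>.2
            nlinarith
          linarith
        simp only
        nlinarith
    rw [integral_add, integral_const_mul] at e2
    · nlinarith [mul_le_mul_of_nonneg_left e1 hK]
    · exact integrable_sq_of_hasCompactSupport hcd.continuous hcs
    · exact hri.const_mul _
  have lim : Tendsto (fun δ : ℝ => K * (∫ x, magneticEnergy φ f g x) + 2 * δ * ∫ x, r x) (𝓝[>] 0)
      (𝓝 (K * (∫ x, magneticEnergy φ f g x) + 2 * 0 * ∫ x, r x)) :=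
    (Continuous.tendsto (by fun_prop) 0).mono_left nhdsWithin_le_nhds
  simp only [mul_zero, zero_mul, add_zero] at lim
  exact ge_of_tendsto lim (by filter_upwards [self_mem_nhdsWithin] with δ hδ using main δ hδ)

end Smooth

/-! ### The Poincaré inequality for test functions. -/

theorem setLIntegral_ofReal_eq {Ω : Set Plane} {F : Plane → ℝ} (hF : Continuous F)
    (hc : HasCompactSupport F) (h0 : ∀ x, 0 ≤ F x) (hΩ : ∀ x ∉ Ω, F x = 0) :
    ∫⁻ x in Ω, ENNReal.ofReal (F x) = ENNReal.ofReal (∫ x, F x) := by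
  rw [ofReal_integral_eq_lintegral_ofReal (hF.integrable_of_hasCompactSupport hc) (ae_of_all _ h0)]
  refine setLIntegral_eq_of_support_subset fun x hx => ?_
  by_contra h
  exact hx (by simp [hΩ x h])

variable {Ω : TopologicalSpace.Opens Plane}

theorem ContDiff.memLp_restrict {h : Plane → ℝ} (hh : ContDiff ℝ ∞ h) (hc : HasCompactSupport h)
    (Ω : Set Plane) : MemLp h 2 (volume.restrict Ω) :=
  (hh.continuous.memLp_of_hasCompactSupport hc).restrict Ω

/-- A test function belongs to `H₀¹`, with its classical gradient. -/
theorem isH10_of_contDiff {h : Plane → ℝ} (hh : ContDiff ℝ ∞ h) (hc : HasCompactSupport h)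
    (hs : tsupport h ⊆ Ω) : IsH10 Ω h fun i => partialDeriv i h where
  memLp := hh.memLp_restrict hc _
  memLp_grad i := (hh.partialDeriv i).memLp_restrict (hc.partialDeriv i) _
  weak_grad i := by
    refine ⟨hh.continuous.locallyIntegrable.locallyIntegrableOn _,
      (hh.partialDeriv i).continuous.locallyIntegrable.locallyIntegrableOn _, fun ψ => ?_⟩
    have hz : ∀ x ∉ (Ω : Set Plane), ψ x = 0 := fun x hx =>
      image_eq_zero_of_notMem_tsupport fun h => hx (ψ.tsupport_subset h)
    have hz' : ∀ x ∉ (Ω : Set Plane), partialDeriv i ψ x = 0 := fun x hx =>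
      partialDeriv_eq_zero_of_notMem_tsupport (fun h => hx (ψ.tsupport_subset h)) i
    rw [setIntegral_eq_integral_of_forall_compl_eq_zero fun x hx => by simp [hz' x hx],
      setIntegral_eq_integral_of_forall_compl_eq_zero fun x hx => by simp [hz x hx]]
    exact integral_mul_partialDeriv hh ψ.contDiff ψ.hasCompactSupport i
  approx := by
    refine ⟨fun _ => ⟨h, hh, hc, hs⟩, ?_, fun i => ?_⟩
    · simp [TendstoL2]
    · simp [TendstoL2]

theorem integral_sq_le_of_poincareConstant_lt {κ : ℝ}
    (hκ : poincareConstant Ω < ENNReal.ofReal κ)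
    {h : Plane → ℝ} (hh : ContDiff ℝ ∞ h) (hc : HasCompactSupport h) (hs : tsupport h ⊆ Ω) :
    ∫ x, h x ^ 2 ≤ κ ^ 2 * ∫ x, ∑ i, partialDeriv i h x ^ 2 := by
  -- The strict bound yields an admissible `k < κ`, so it need not be known that the infimum is
  -- attained.
  obtain ⟨k, hk, hkκ⟩ := sInf_lt_iff.1 hκ
  have hκ0 : 0 ≤ κ := by
    by_contra hneg
    simp [ENNReal.ofReal_of_nonpos (not_le.1 hneg).le] at hkκ
  have hz : ∀ x ∉ (Ω : Set Plane), x ∉ tsupport h := fun x hx hx' => hx (hs hx')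
  have key := hk h _ (isH10_of_contDiff hh hc hs)
  have e : ∀ t : ℝ, ‖t‖ₑ ^ 2 = ENNReal.ofReal (t ^ 2) := fun t => by
    rw [Real.enorm_eq_ofReal_abs, ← ENNReal.ofReal_pow (abs_nonneg _), sq_abs]
  have es : ∀ x, ∑ i, ‖partialDeriv i h x‖ₑ ^ 2 = ENNReal.ofReal (∑ i, partialDeriv i h x ^ 2) := by
    intro x
    rw [ENNReal.ofReal_sum_of_nonneg fun i _ => sq_nonneg _]
    exact Finset.sum_congr rfl fun i _ => e _
  have hcont : Continuous fun x => ∑ i, partialDeriv i h x ^ 2 :=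
    continuous_finsetSum _ fun i _ => (hh.partialDeriv i).continuous.pow 2
  have hzero : ∀ x ∉ tsupport h, ∑ i, partialDeriv i h x ^ 2 = 0 := fun x hx => by
    simp [partialDeriv_eq_zero_of_notMem_tsupport hx]
  simp_rw [es, e] at key
  rw [setLIntegral_ofReal_eq (F := fun x => h x ^ 2) (hh.continuous.pow 2)
      (HasCompactSupport.intro hc fun {x} hx => by simp [image_eq_zero_of_notMem_tsupport hx])
      (fun x => sq_nonneg _) (fun x hx => by simp [image_eq_zero_of_notMem_tsupport (hz x hx)]),
    setLIntegral_ofReal_eq hcont (HasCompactSupport.intro hc fun {x} hx => hzero x hx)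
      (fun x => Finset.sum_nonneg fun i _ => sq_nonneg _) fun x hx => hzero x (hz x hx)] at key
  have hI : 0 ≤ ∫ x, ∑ i, partialDeriv i h x ^ 2 :=
    integral_nonneg fun x => Finset.sum_nonneg fun i _ => sq_nonneg _
  have key2 := key.trans (mul_le_mul_left (pow_le_pow_left₀ zero_le hkκ.le 2) _)
  rw [← ENNReal.ofReal_pow hκ0, ← ENNReal.ofReal_mul (by positivity)] at key2
  exact (ENNReal.ofReal_le_ofReal_iff (by positivity)).1 key2

/-! ### Localisation of the weight. -/

/-- The integral identities use a weight smooth on the whole plane, while `φ` is controlled only in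
`Ω`. Agreement on neighbourhoods, not just on `K`, carries the Laplacian over too. -/
theorem exists_contDiff_eventuallyEq {φ : Plane → ℝ} (hφ : ContDiffOn ℝ ∞ φ (Ω : Set Plane))
    {K : Set Plane} (hK : IsCompact K) (hKΩ : K ⊆ Ω) :
    ∃ φ' : Plane → ℝ, ContDiff ℝ ∞ φ' ∧ ∀ x ∈ K, φ' =ᶠ[𝓝 x] φ := by
  obtain ⟨χ, hχ, -, hsub, h1⟩ := exists_contDiff_cutoff hK Ω.isOpen hKΩ
  refine ⟨fun x => χ x * φ x, contDiff_iff_contDiffAt.2 fun x => ?_, fun x hx => ?_⟩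
  · by_cases hx : x ∈ tsupport χ
    · exact hχ.contDiffAt.mul (hφ.contDiffAt (Ω.isOpen.mem_nhds (hsub hx)))
    · refine contDiffAt_const (c := (0 : ℝ)) |>.congr_of_eventuallyEq ?_
      filter_upwards [notMem_tsupport_iff_eventuallyEq.1 hx] with y hy
      simp [hy]
  · filter_upwards [h1 x hx] with y hy
    simp [hy]

theorem weightedIntegral_eq_ofReal_integral {φ φ' F : Plane → ℝ} (hφ : ContDiff ℝ ∞ φ')
    (hF : Continuous F) (h0 : ∀ x, 0 ≤ F x) {K : Set Plane} (hK : IsCompact K) (hKΩ : K ⊆ Ω)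
    (heq : ∀ x ∈ K, φ' x = φ x) (hz : ∀ x ∉ K, F x = 0) :
    weightedIntegral Ω φ F = ENNReal.ofReal (∫ x, Real.exp (-φ' x) * F x) := by
  have : weightedIntegral Ω φ F = weightedIntegral Ω φ' F := by
    unfold weightedIntegral
    congr 1 with x
    by_cases hx : x ∈ K
    · rw [heq x hx]
    · simp [hz x hx]
  rw [this]
  have := hφ.continuous
  refine setLIntegral_ofReal_eq (by fun_prop)
    (HasCompactSupport.intro hK fun {x} hx => by simp [hz x hx])
    (fun x => mul_nonneg (Real.exp_pos _).le (h0 x)) fun x hx => by simp [hz x fun h => hx (hKΩ h)]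

/-! ### Weighted estimates for test functions. -/

section Estimates

variable {φ : Plane → ℝ} (hφ : ContDiffOn ℝ ∞ φ (Ω : Set Plane))
  {s : ℝ} (hs0 : 0 < s) (hs : ∀ x ∈ Ω, s ≤ -(Laplacian.laplacian φ x))
  {κ : ℝ} (hκ : poincareConstant Ω < ENNReal.ofReal κ)

include hφ hs0 hs hκ in
-- For `c = 2 / s` the magnetic energy is discarded and the curvature term kept; for `c = κ ^ 2` it
-- is the other way round.
theorem weightedIntegral_sq_add_sq_le {f g : Plane → ℝ} (hf : ContDiff ℝ ∞ f)
    (hg : ContDiff ℝ ∞ g) (hfc : HasCompactSupport f) (hgc : HasCompactSupport g)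
    (hfΩ : tsupport f ⊆ Ω) (hgΩ : tsupport g ⊆ Ω) {c : ℝ} (hc : c = 2 / s ∨ c = κ ^ 2) :
    weightedIntegral Ω φ (fun x => f x ^ 2 + g x ^ 2) ≤ ENNReal.ofReal c *
      weightedIntegral Ω φ (fun x => (partialDeriv 0 f x + partialDeriv 1 g x) ^ 2 +
        (partialDeriv 0 g x - partialDeriv 1 f x) ^ 2) := by
  have hK : IsCompact (tsupport f ∪ tsupport g) := IsCompact.union hfc hgc
  have hKΩ : tsupport f ∪ tsupport g ⊆ Ω := Set.union_subset hfΩ hgΩ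
  obtain ⟨φ', hφ', heq⟩ := exists_contDiff_eventuallyEq hφ hK hKΩ
  have heq' : ∀ x ∈ tsupport f ∪ tsupport g, φ' x = φ x := fun x hx => (heq x hx).eq_of_nhds
  have c1 := (hf.partialDeriv 0).continuous
  have c2 := (hf.partialDeriv 1).continuous
  have c3 := (hg.partialDeriv 0).continuous
  have c4 := (hg.partialDeriv 1).continuous
  have c5 := hf.continuous
  have c6 := hg.continuous
  have hs' : ∀ x ∈ tsupport f ∪ tsupport g,
      s ≤ -∑ i, partialDeriv i (partialDeriv i φ') x := fun x hx => by
    rw [← laplacian_eq_sum_partialDeriv hφ', (InnerProductSpace.laplacian_congr_nhds (heq x hx)).eq_of_nhds]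
    exact hs x (hKΩ hx)
  have hc0 : 0 ≤ c := by rcases hc with rfl | rfl <;> positivity
  rw [weightedIntegral_eq_ofReal_integral hφ' (by fun_prop) (fun x => by positivity) hK hKΩ heq',
    weightedIntegral_eq_ofReal_integral hφ' (by fun_prop) (fun x => by positivity) hK hKΩ heq',
    ← ENNReal.ofReal_mul hc0]
  · refine ENNReal.ofReal_le_ofReal ?_
    have E1 := mul_integral_le_integral_divCurlEnergy hφ' hf hg hfc hgc hs'
    rcases hc with rfl | rfl
    · change _ ≤ 2 / s * ∫ x, divCurlEnergy φ' f g x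
      calc _ = 2 / s * (s / 2 * ∫ x, Real.exp (-φ' x) * (f x ^ 2 + g x ^ 2)) := by
            field_simp
        _ ≤ _ := mul_le_mul_of_nonneg_left E1 (by positivity)
    · have E2 := integral_le_mul_integral_magneticEnergy hφ' hf hg hfc hgc hfΩ hgΩ (sq_nonneg κ)
        fun h hh hhc hhs => integral_sq_le_of_poincareConstant_lt hκ hh hhc hhs
      refine E2.trans (mul_le_mul_of_nonneg_left ?_ (sq_nonneg κ))
      change _ ≤ ∫ x, divCurlEnergy φ' f g x
      rw [integral_divCurlEnergy_eq hφ' hf hg hfc hgc]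
      have : 0 ≤ ∫ x, -(∑ i, partialDeriv i (partialDeriv i φ') x) *
        (Real.exp (-φ' x) * (f x ^ 2 + g x ^ 2)) := by
        refine integral_nonneg fun x => ?_
        by_cases hx : x ∈ tsupport f ∪ tsupport g
        · exact mul_nonneg (hs0.le.trans (hs' x hx)) (by positivity)
        · rw [Set.mem_union, not_or] at hx
          simp [image_eq_zero_of_notMem_tsupport hx.1, image_eq_zero_of_notMem_tsupport hx.2]
      linarith
  · intro x hx
    rw [Set.mem_union, not_or] at hx
    simp [partialDeriv_eq_zero_of_notMem_tsupport hx.1, partialDeriv_eq_zero_of_notMem_tsupport hx.2]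
  · intro x hx
    rw [Set.mem_union, not_or] at hx
    simp [image_eq_zero_of_notMem_tsupport hx.1, image_eq_zero_of_notMem_tsupport hx.2]

variable {ψ : Plane → ℝ} (hψ : ContDiff ℝ ∞ ψ) (hψc : HasCompactSupport ψ) (hψΩ : tsupport ψ ⊆ Ω)
  {c : ℝ} (hc : c = 2 / s ∨ c = κ ^ 2)

include hφ hs0 hs hκ hψ hψc hψΩ hc

/-- The field `(ψ, 0)` has divergence `∂₀ψ` and curl `-∂₁ψ`. -/
theorem weightedIntegral_sq_le_gradient : weightedIntegral Ω φ (fun x => ψ x ^ 2) ≤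
    ENNReal.ofReal c * weightedIntegral Ω φ (fun x => ∑ i, partialDeriv i ψ x ^ 2) := by
  have := weightedIntegral_sq_add_sq_le hφ hs0 hs hκ hψ (contDiff_const (c := (0 : ℝ))) hψc
    (HasCompactSupport.zero (α := Plane)) hψΩ (by simp [tsupport]) hc
  simpa [partialDeriv, Fin.sum_univ_two] using this

/-- The field `∇ψ` has divergence `Δψ` and, by symmetry of second derivatives, no curl. -/
theorem weightedIntegral_gradient_le_laplacian :
    weightedIntegral Ω φ (fun x => ∑ i, partialDeriv i ψ x ^ 2) ≤ ENNReal.ofReal c *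
      weightedIntegral Ω φ (fun x => (∑ i, partialDeriv i (partialDeriv i ψ) x) ^ 2) := by
  have := weightedIntegral_sq_add_sq_le hφ hs0 hs hκ (hψ.partialDeriv 0) (hψ.partialDeriv 1)
    (hψc.partialDeriv 0) (hψc.partialDeriv 1) ((tsupport_partialDeriv_subset _ _).trans hψΩ)
    ((tsupport_partialDeriv_subset _ _).trans hψΩ) hc
  simpa [Fin.sum_univ_two, partialDeriv_comm hψ 1 0] using this

/-- Single components are needed because the passage to the limit is carried out for the square of
one function. -/
theorem weightedIntegral_partialDeriv_sq_le_laplacian (i : Fin 2) :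
    weightedIntegral Ω φ (fun x => partialDeriv i ψ x ^ 2) ≤ ENNReal.ofReal c *
      weightedIntegral Ω φ (fun x => (∑ i, partialDeriv i (partialDeriv i ψ) x) ^ 2) := by
  refine le_trans (lintegral_mono fun x => ENNReal.ofReal_le_ofReal ?_)
    (weightedIntegral_gradient_le_laplacian hφ hs0 hs hκ hψ hψc hψΩ hc)
  exact mul_le_mul_of_nonneg_left (Finset.single_le_sum (f := fun j => partialDeriv j ψ x ^ 2)
    (fun j _ => sq_nonneg _) (Finset.mem_univ i)) (Real.exp_pos _).le

theorem weightedIntegral_sq_le_laplacian :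
    weightedIntegral Ω φ (fun x => ψ x ^ 2) ≤ ENNReal.ofReal (c ^ 2) *
      weightedIntegral Ω φ (fun x => (∑ i, partialDeriv i (partialDeriv i ψ) x) ^ 2) := by
  have hc0 : 0 ≤ c := by rcases hc with rfl | rfl <;> positivity
  rw [pow_two, ENNReal.ofReal_mul hc0, mul_assoc]
  exact (weightedIntegral_sq_le_gradient hφ hs0 hs hκ hψ hψc hψΩ hc).trans
    (mul_le_mul_right (weightedIntegral_gradient_le_laplacian hφ hs0 hs hκ hψ hψc hψΩ hc) _)

end Estimates

/-! ### Supports of weak derivatives and weighted convergence. -/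

/-- A weak derivative vanishes almost everywhere where the function does. -/
theorem HasWeakPartial.ae_eq_zero {i : Fin 2} {u g : Plane → ℝ} (h : HasWeakPartial Ω i u g)
    {T : Set Plane} (hT : IsClosed T) (hu : ∀ᵐ x, x ∈ (Ω : Set Plane) → x ∉ T → u x = 0) :
    ∀ᵐ x, x ∈ (Ω : Set Plane) → x ∉ T → g x = 0 := by
  obtain ⟨-, hg, hw⟩ := h
  have key := (Ω.isOpen.sdiff hT).ae_eq_zero_of_integral_contDiff_smul_eq_zero
    (μ := volume) (f := g) (hg.mono_set Set.sdiff_subset) ?_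
  · filter_upwards [key] with x hx h1 h2 using hx ⟨h1, h2⟩
  · intro θ hθ hθc hθs
    have hw' := hw ⟨θ, hθ, hθc, hθs.trans Set.sdiff_subset⟩
    -- The test function `θ` is supported in `Ω \ T`: its derivative vanishes on `T`, and `u`
    -- vanishes off `T`.
    have e : ∫ x in (Ω : Set Plane), u x * partialDeriv i θ x = 0 := by
      refine setIntegral_eq_zero_of_ae_eq_zero ?_
      filter_upwards [hu] with x hx hxΩ
      by_cases hxT : x ∈ T
      · rw [partialDeriv_eq_zero_of_notMem_tsupport (fun h => (hθs h).2 hxT), mul_zero]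
      · rw [hx hxΩ hxT, zero_mul]
    have e2 : ∫ x in (Ω : Set Plane), g x * θ x = 0 := by
      change ∫ x in (Ω : Set Plane), u x * partialDeriv i θ x =
        -∫ x in (Ω : Set Plane), g x * θ x at hw'
      linarith
    rw [setIntegral_eq_integral_of_forall_compl_eq_zero fun x hx => by
      rw [image_eq_zero_of_notMem_tsupport fun h => hx (hθs h).1, mul_zero]] at e2
    simpa [mul_comm] using e2

/-- Convergence in `L²(Ω)` after multiplication with `e^{-φ/2}`. -/
structure WeightedTendsto (Ω : TopologicalSpace.Opens Plane) (φ : Plane → ℝ)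
    (f : ℕ → Plane → ℝ) (g : Plane → ℝ) : Prop where
  seq_aesm : ∀ n, AEStronglyMeasurable (f n) (volume.restrict (Ω : Set Plane))
  lim_aesm : AEStronglyMeasurable g (volume.restrict (Ω : Set Plane))
  tendsto : Tendsto (fun n => eLpNorm (fun x => Real.exp (-φ x / 2) * (f n x - g x)) 2
    (volume.restrict (Ω : Set Plane))) atTop (𝓝 0)

theorem weightedIntegral_sq_eq (φ f : Plane → ℝ) :
    weightedIntegral Ω φ (fun x => f x ^ 2) =
      eLpNorm (fun x => Real.exp (-φ x / 2) * f x) 2 (volume.restrict (Ω : Set Plane)) ^ 2 := by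
  have h := eLpNorm_nnreal_pow_eq_lintegral (f := fun x => Real.exp (-φ x / 2) * f x)
    (μ := volume.restrict (Ω : Set Plane)) (p := 2) (by simp)
  simp only [NNReal.coe_ofNat, ENNReal.coe_ofNat, ENNReal.rpow_ofNat] at h
  rw [h]
  unfold weightedIntegral
  congr 1 with x
  rw [Real.enorm_eq_ofReal_abs, ← ENNReal.ofReal_pow (abs_nonneg _), sq_abs, mul_pow,
    ← Real.exp_nat_mul]
  congr 3
  push_cast; ring_nf

section

variable {φ : Plane → ℝ} (hφ : ContinuousOn φ (Ω : Set Plane))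

include hφ in
theorem ContinuousOn.aesm_exp_mul {f : Plane → ℝ}
    (hf : AEStronglyMeasurable f (volume.restrict (Ω : Set Plane))) :
    AEStronglyMeasurable (fun x => Real.exp (-φ x / 2) * f x)
      (volume.restrict (Ω : Set Plane)) :=
  (ContinuousOn.aestronglyMeasurable (by fun_prop) Ω.isOpen.measurableSet).mul hf

include hφ in
theorem WeightedTendsto.add {f f' : ℕ → Plane → ℝ} {g g' : Plane → ℝ}
    (h : WeightedTendsto Ω φ f g) (h' : WeightedTendsto Ω φ f' g') :
    WeightedTendsto Ω φ (fun n x => f n x + f' n x) (fun x => g x + g' x) where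
  seq_aesm n := (h.seq_aesm n).add (h'.seq_aesm n)
  lim_aesm := h.lim_aesm.add h'.lim_aesm
  tendsto := by
    refine tendsto_of_tendsto_of_tendsto_of_le_of_le tendsto_const_nhds
      (by simpa using h.tendsto.add h'.tendsto) (fun _ => zero_le) fun n => ?_
    refine le_trans (le_of_eq ?_) (eLpNorm_add_le (hφ.aesm_exp_mul ((h.seq_aesm n).sub h.lim_aesm))
      (hφ.aesm_exp_mul ((h'.seq_aesm n).sub h'.lim_aesm)) (by norm_num))
    congr 1 with x
    simp only [Pi.add_apply]
    ring

theorem WeightedTendsto.congr_ae {f : ℕ → Plane → ℝ} {g g' : Plane → ℝ}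
    (h : WeightedTendsto Ω φ f g) (hg : g =ᵐ[volume.restrict (Ω : Set Plane)] g') :
    WeightedTendsto Ω φ f g' where
  seq_aesm := h.seq_aesm
  lim_aesm := h.lim_aesm.congr hg
  tendsto := by
    refine h.tendsto.congr fun n => eLpNorm_congr_ae ?_
    filter_upwards [hg] with x hx
    rw [hx]

/-- On the support of `θ` within `Ω`, `e^{-φ/2}` is at most `e^{-m/2}` for a lower bound `m` of `φ`,
so multiplication by `e^{-φ/2} θ` is bounded on `L²(Ω)`. -/
theorem TendstoL2.weightedTendsto_mul {f : ℕ → Plane → ℝ} {g : Plane → ℝ}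
    (h : TendstoL2 Ω f g) (hf : ∀ n, AEStronglyMeasurable (f n) (volume.restrict (Ω : Set Plane)))
    (hg : AEStronglyMeasurable g (volume.restrict (Ω : Set Plane)))
    {θ : Plane → ℝ} (hθ : Continuous θ) (hθc : HasCompactSupport θ) {U : Set Plane}
    (hθU : tsupport θ ⊆ U) (hU : BddBelow (φ '' (U ∩ (Ω : Set Plane)))) :
    WeightedTendsto Ω φ (fun n x => θ x * f n x) (fun x => θ x * g x) where
  seq_aesm n := hθ.aestronglyMeasurable.mul (hf n)
  lim_aesm := hθ.aestronglyMeasurable.mul hg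
  tendsto := by
    obtain ⟨m, hm⟩ := hU
    obtain ⟨B, hB⟩ := hθ.bounded_above_of_compact_support hθc
    have hB0 : 0 ≤ B := (norm_nonneg _).trans (hB 0)
    have hlim : Tendsto (fun n => ENNReal.ofReal (Real.exp (-m / 2) * B) *
        eLpNorm (f n - g) 2 (volume.restrict (Ω : Set Plane))) atTop (𝓝 0) := by
      simpa using ENNReal.Tendsto.const_mul h (Or.inr ENNReal.ofReal_ne_top)
    refine tendsto_of_tendsto_of_tendsto_of_le_of_le tendsto_const_nhds hlim
      (fun _ => zero_le) fun n => ?_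
    refine eLpNorm_le_mul_eLpNorm_of_ae_le_mul ?_ _
    filter_upwards [ae_restrict_mem Ω.isOpen.measurableSet] with x hx
    rw [← mul_sub, ← mul_assoc, norm_mul, Pi.sub_apply]
    refine mul_le_mul_of_nonneg_right ?_ (norm_nonneg _)
    by_cases hxU : x ∈ U
    · rw [norm_mul, Real.norm_of_nonneg (Real.exp_pos _).le]
      have : m ≤ φ x := hm ⟨x, ⟨hxU, hx⟩, rfl⟩
      refine mul_le_mul (Real.exp_le_exp.2 (by linarith)) (hB x) (norm_nonneg _)
        (Real.exp_pos _).le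
    · rw [image_eq_zero_of_notMem_tsupport fun h => hxU (hθU h), mul_zero, norm_zero]
      exact mul_nonneg (Real.exp_pos _).le hB0

include hφ in
theorem ContinuousOn.eLpNorm_exp_mul_add_le {f g : Plane → ℝ}
    (hf : AEStronglyMeasurable f (volume.restrict (Ω : Set Plane)))
    (hg : AEStronglyMeasurable g (volume.restrict (Ω : Set Plane))) :
    eLpNorm (fun x => Real.exp (-φ x / 2) * (f x + g x)) 2 (volume.restrict (Ω : Set Plane)) ≤
      eLpNorm (fun x => Real.exp (-φ x / 2) * f x) 2 (volume.restrict (Ω : Set Plane)) +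
        eLpNorm (fun x => Real.exp (-φ x / 2) * g x) 2 (volume.restrict (Ω : Set Plane)) := by
  simp only [mul_add]
  exact eLpNorm_add_le (hφ.aesm_exp_mul hf) (hφ.aesm_exp_mul hg) (by norm_num)

include hφ in
/-- Weighted `L²` bounds pass to the limit. -/
theorem WeightedTendsto.weightedIntegral_le {a b : ℕ → Plane → ℝ} {a₀ b₀ : Plane → ℝ}
    (ha : WeightedTendsto Ω φ a a₀) (hb : WeightedTendsto Ω φ b b₀) {c : ℝ} (hc : 0 ≤ c)
    (hle : ∀ n, weightedIntegral Ω φ (fun x => a n x ^ 2) ≤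
      ENNReal.ofReal c * weightedIntegral Ω φ (fun x => b n x ^ 2)) :
    weightedIntegral Ω φ (fun x => a₀ x ^ 2) ≤
      ENNReal.ofReal c * weightedIntegral Ω φ (fun x => b₀ x ^ 2) := by
  have hcs : ENNReal.ofReal c = ENNReal.ofReal √c ^ 2 := by
    rw [← ENNReal.ofReal_pow (Real.sqrt_nonneg _), Real.sq_sqrt hc]
  simp only [weightedIntegral_sq_eq, hcs, ← mul_pow,
    ENNReal.pow_le_pow_left_iff two_ne_zero] at hle ⊢
  -- The triangle inequality is used on both sides, for `a₀ = a n - (a n - a₀)` and `b n = b₀ + (b n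
  -- - b₀)`; no norm has to be finite.
  have step : ∀ n, _ ≤ _ := fun n => calc
    eLpNorm (fun x => Real.exp (-φ x / 2) * a₀ x) 2 (volume.restrict (Ω : Set Plane))
      = eLpNorm (fun x => Real.exp (-φ x / 2) * (a n x + -(a n x - a₀ x))) 2
          (volume.restrict (Ω : Set Plane)) := by
        congr 1 with x; ring
    _ ≤ eLpNorm (fun x => Real.exp (-φ x / 2) * a n x) 2 (volume.restrict (Ω : Set Plane)) +
        eLpNorm (fun x => Real.exp (-φ x / 2) * -(a n x - a₀ x)) 2
          (volume.restrict (Ω : Set Plane)) :=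
        hφ.eLpNorm_exp_mul_add_le (ha.seq_aesm n) ((ha.seq_aesm n).sub ha.lim_aesm).neg
    _ = eLpNorm (fun x => Real.exp (-φ x / 2) * a n x) 2 (volume.restrict (Ω : Set Plane)) +
        eLpNorm (fun x => Real.exp (-φ x / 2) * (a n x - a₀ x)) 2
          (volume.restrict (Ω : Set Plane)) := by
        congr 1
        rw [← eLpNorm_neg]
        congr 1 with x
        simp only [Pi.neg_apply]
        ring
    _ ≤ ENNReal.ofReal √c *
        (eLpNorm (fun x => Real.exp (-φ x / 2) * b₀ x) 2 (volume.restrict (Ω : Set Plane)) +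
        eLpNorm (fun x => Real.exp (-φ x / 2) * (b n x - b₀ x)) 2
          (volume.restrict (Ω : Set Plane))) +
        eLpNorm (fun x => Real.exp (-φ x / 2) * (a n x - a₀ x)) 2
          (volume.restrict (Ω : Set Plane)) := by
        refine add_le_add_left ((hle n).trans (mul_le_mul_right ?_ _)) _
        have := hφ.eLpNorm_exp_mul_add_le hb.lim_aesm ((hb.seq_aesm n).sub hb.lim_aesm)
        simpa only [Pi.sub_apply, add_sub_cancel] using this
  have lim := (ENNReal.Tendsto.const_mul (a := ENNReal.ofReal √c) (tendsto_const_nhds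
    (x := eLpNorm (fun x => Real.exp (-φ x / 2) * b₀ x) 2 (volume.restrict (Ω : Set Plane)))
      |>.add hb.tendsto) (Or.inr ENNReal.ofReal_ne_top)).add ha.tendsto
  rw [add_zero, add_zero] at lim
  exact ge_of_tendsto' lim step

end

/-! ### Approximation in the weighted norms. -/

theorem partialDeriv_partialDeriv_mul {χ ψ : Plane → ℝ} (hχ : ContDiff ℝ ∞ χ)
    (hψ : ContDiff ℝ ∞ ψ) (i : Fin 2) (x : Plane) :
    partialDeriv i (partialDeriv i fun y => χ y * ψ y) x =
      partialDeriv i (partialDeriv i χ) x * ψ x + 2 * partialDeriv i χ x * partialDeriv i ψ x +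
        χ x * partialDeriv i (partialDeriv i ψ) x := by
  have h1 := hχ.differentiable (by simp)
  have h2 := hψ.differentiable (by simp)
  have h3 := (hχ.partialDeriv i).differentiable (by simp)
  have h4 := (hψ.partialDeriv i).differentiable (by simp)
  have : (partialDeriv i fun y => χ y * ψ y) =
      fun y => partialDeriv i χ y * ψ y + χ y * partialDeriv i ψ y :=
    funext fun y => partialDeriv_mul i (h1 y) (h2 y)
  rw [this, partialDeriv_add _ (by fun_prop) (by fun_prop),
    partialDeriv_mul _ (by fun_prop) (by fun_prop), partialDeriv_mul _ (by fun_prop) (by fun_prop)]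
  ring

/-- Test functions that approximate an element of `H₀²(Ω)` in the weighted norms. -/
theorem IsH20.exists_weightedTendsto {φ : Plane → ℝ} (hφ : ContinuousOn φ (Ω : Set Plane))
    (hΩ : Bornology.IsBounded (Ω : Set Plane))
    {u : Plane → ℝ} {p : Fin 2 → Plane → ℝ} {q : Fin 2 → Fin 2 → Plane → ℝ} (h : IsH20 Ω u p q)
    {U : Set Plane} (hU : IsOpen U) (hsub : closure {x | x ∈ Ω ∧ u x ≠ 0} ⊆ U)
    (hbdd : BddBelow (φ '' (U ∩ (Ω : Set Plane)))) :
    ∃ v : ℕ → Plane → ℝ, (∀ n, ContDiff ℝ ∞ (v n) ∧ HasCompactSupport (v n) ∧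
        tsupport (v n) ⊆ Ω) ∧
      WeightedTendsto Ω φ v u ∧
      (∀ i, WeightedTendsto Ω φ (fun n => partialDeriv i (v n)) (p i)) ∧
      WeightedTendsto Ω φ (fun n x => ∑ i, partialDeriv i (partialDeriv i (v n)) x)
        (fun x => ∑ i, q i i x) := by
  set T := closure {x | x ∈ Ω ∧ u x ≠ 0} with hT
  have hTc : IsCompact T := (hΩ.subset fun x hx => hx.1).isCompact_closure
  -- The set `T` may touch the boundary of `Ω`, so `χ` need not be supported in `Ω`; the products `χ
  -- ψ n` are, thanks to `ψ n`.
  obtain ⟨χ, hχ, hχc, hχU, hχ1⟩ := exists_contDiff_cutoff hTc hU hsub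
  obtain ⟨ψ, hψ0, hψ1, hψ2⟩ := h.approx
  have hu0 : ∀ᵐ x, x ∈ (Ω : Set Plane) → x ∉ T → u x = 0 := ae_of_all _ fun x hx hxT => by
    by_contra hne
    exact hxT (subset_closure ⟨hx, hne⟩)
  have hp0 : ∀ i, ∀ᵐ x, x ∈ (Ω : Set Plane) → x ∉ T → p i x = 0 := fun i =>
    (h.weak_grad i).ae_eq_zero isClosed_closure hu0
  have hq0 : ∀ i j, ∀ᵐ x, x ∈ (Ω : Set Plane) → x ∉ T → q i j x = 0 := fun i j =>
    (h.weak_hess i j).ae_eq_zero isClosed_closure (hp0 j)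
  have hd1 : ∀ i, ∀ x ∈ T, partialDeriv i χ =ᶠ[𝓝 x] fun _ => 0 := fun i x hx => by
    have := (hχ1 x hx).partialDeriv i
    have e : partialDeriv i (fun _ : Plane => (1 : ℝ)) = fun _ => 0 := by
      ext; simp [partialDeriv]
    rwa [e] at this
  have hd2 : ∀ i, ∀ x ∈ T, partialDeriv i (partialDeriv i χ) x = 0 := fun i x hx => by
    rw [((hd1 i x hx).partialDeriv i).eq_of_nhds]; simp [partialDeriv]
  have meas : ∀ {f : Plane → ℝ}, ContDiff ℝ ∞ f →
      AEStronglyMeasurable f (volume.restrict (Ω : Set Plane)) :=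
    fun hf => hf.continuous.aestronglyMeasurable
  have ψd := fun n => (ψ n).contDiff
  have mul0 : ∀ {θ : Plane → ℝ}, ContDiff ℝ ∞ θ → HasCompactSupport θ → tsupport θ ⊆ U →
      WeightedTendsto Ω φ (fun n x => θ x * ψ n x) (fun x => θ x * u x) := fun hθ hθc hθU =>
    hψ0.weightedTendsto_mul (fun n => meas (ψd n)) h.memLp.1 hθ.continuous hθc hθU hbdd
  have mul1 : ∀ (i : Fin 2) {θ : Plane → ℝ}, ContDiff ℝ ∞ θ → HasCompactSupport θ →
      tsupport θ ⊆ U → WeightedTendsto Ω φ (fun n x => θ x * partialDeriv i (ψ n) x)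
        (fun x => θ x * p i x) := fun i _ hθ hθc hθU =>
    (hψ1 i).weightedTendsto_mul (fun n => meas ((ψd n).partialDeriv i)) (h.memLp_grad i).1
      hθ.continuous hθc hθU hbdd
  have mul2 : ∀ (i : Fin 2) {θ : Plane → ℝ}, ContDiff ℝ ∞ θ → HasCompactSupport θ →
      tsupport θ ⊆ U → WeightedTendsto Ω φ
        (fun n x => θ x * partialDeriv i (partialDeriv i (ψ n)) x)
        (fun x => θ x * q i i x) := fun i _ hθ hθc hθU =>
    (hψ2 i i).weightedTendsto_mul (fun n => meas (((ψd n).partialDeriv i).partialDeriv i))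
      (h.memLp_hess i i).1 hθ.continuous hθc hθU hbdd
  have hχi : ∀ i, tsupport (partialDeriv i χ) ⊆ U := fun i =>
    (tsupport_partialDeriv_subset i χ).trans hχU
  -- The Leibniz expansion converges term by term to `∂ᵢ²χ u + 2 ∂ᵢχ pᵢ + χ qᵢᵢ`. This is `qᵢᵢ`
  -- almost everywhere in `Ω`: on `T` one has `χ = 1` with vanishing derivatives, and off `T` all of
  -- `u`, `pᵢ`, `qᵢᵢ` vanish.
  have lap : ∀ i, WeightedTendsto Ω φ
      (fun n => partialDeriv i (partialDeriv i fun x => χ x * ψ n x)) (q i i) := by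
    intro i
    have w := ((mul0 ((hχ.partialDeriv i).partialDeriv i) ((hχc.partialDeriv i).partialDeriv i)
      ((tsupport_partialDeriv_subset i _).trans (hχi i))).add hφ
      (mul1 i (contDiff_const (c := (2 : ℝ)) |>.mul (hχ.partialDeriv i))
        (hχc.partialDeriv i).mul_left
        ((closure_mono (Function.support_mul_subset_right _ _)).trans (hχi i)))).add hφ
      (mul2 i hχ hχc hχU)
    have w' := w.congr_ae (g' := q i i) ?_
    · convert w' using 3 with n
      exact partialDeriv_partialDeriv_mul hχ (ψd n) i _
    · filter_upwards [ae_restrict_mem Ω.isOpen.measurableSet, ae_restrict_of_ae hu0,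
        ae_restrict_of_ae (hp0 i), ae_restrict_of_ae (hq0 i i)] with x hx h0 h1 h2
      by_cases hxT : x ∈ T
      · simp [hd2 i x hxT, (hd1 i x hxT).eq_of_nhds, (hχ1 x hxT).eq_of_nhds]
      · simp [h0 hx hxT, h1 hx hxT, h2 hx hxT]
  refine ⟨fun n x => χ x * ψ n x, fun n => ⟨hχ.mul (ψd n), (ψ n).hasCompactSupport.mul_left,
    (closure_mono (Function.support_mul_subset_right _ _)).trans (ψ n).tsupport_subset⟩, ?_,
    fun i => ?_, ?_⟩
  · refine (mul0 hχ hχc hχU).congr_ae ?_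
    filter_upwards [ae_restrict_mem Ω.isOpen.measurableSet, ae_restrict_of_ae hu0] with x hx h0
    by_cases hxT : x ∈ T
    · simp [(hχ1 x hxT).eq_of_nhds]
    · simp [h0 hx hxT]
  · have w := (mul0 (hχ.partialDeriv i) (hχc.partialDeriv i) (hχi i)).add hφ (mul1 i hχ hχc hχU)
    have w' := w.congr_ae (g' := p i) ?_
    · convert w' using 3 with n
      exact partialDeriv_mul i (hχ.differentiable (by simp) _) ((ψd n).differentiable (by simp) _)
    · filter_upwards [ae_restrict_mem Ω.isOpen.measurableSet, ae_restrict_of_ae hu0,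
        ae_restrict_of_ae (hp0 i)] with x hx h0 h1
      by_cases hxT : x ∈ T
      · simp [(hd1 i x hxT).eq_of_nhds, (hχ1 x hxT).eq_of_nhds]
      · simp [h0 hx hxT, h1 hx hxT]
  · simp only [Fin.sum_univ_two]
    exact (lap 0).add hφ (lap 1)

/-! ### The weighted estimate in `H₀²`. -/

theorem mainTheorem8 (C' : ℝ) (hC' : 1 ≤ C') :
    ∃ C : ℝ, 0 < C ∧ ∀ ε : ℝ, 0 < ε →
      ∀ Ω : TopologicalSpace.Opens Plane, Bornology.IsBounded (Ω : Set Plane) →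
        poincareConstant Ω ^ 2 ≤ ENNReal.ofReal (C' ^ 2 * ε ^ 2) →
      ∀ s : ℝ, 1 ≤ s →
      ∀ φ : Plane → ℝ, ContDiffOn ℝ ∞ φ (Ω : Set Plane) →
        (∀ x ∈ Ω, s ≤ -(Laplacian.laplacian φ x)) →
      ∀ (u : Plane → ℝ) (p : Fin 2 → Plane → ℝ) (q : Fin 2 → Fin 2 → Plane → ℝ),
        IsH20 Ω u p q →
        -- `e^{-φ}` is bounded near the support of `u`
        (∃ U : Set Plane, IsOpen U ∧ closure {x | x ∈ Ω ∧ u x ≠ 0} ⊆ U ∧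
          BddBelow (φ '' (U ∩ (Ω : Set Plane)))) →
        ENNReal.ofReal (ε ^ (-4 : ℤ)) * weightedIntegral Ω φ (fun x => |u x| ^ 2)
          + ENNReal.ofReal (s ^ 2) * weightedIntegral Ω φ (fun x => |u x| ^ 2)
          + ENNReal.ofReal (ε ^ (-2 : ℤ)) * weightedIntegral Ω φ (fun x => ∑ i, p i x ^ 2)
          + ENNReal.ofReal s * weightedIntegral Ω φ (fun x => ∑ i, p i x ^ 2)
        ≤ ENNReal.ofReal C * weightedIntegral Ω φ (fun x => |∑ i, q i i x| ^ 2) := by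
  -- One summand per term on the left, with `κ = 2C'ε`: `ε⁻⁴ κ⁴`, `s² (2/s)²`, `ε⁻² · 2κ²` and `s ·
  -- 2(2/s)`. The factor `2` in the gradient terms comes from bounding the two components
  -- separately.
  refine ⟨16 * C' ^ 4 + 4 + 8 * C' ^ 2 + 4, by positivity, ?_⟩
  intro ε hε Ω hΩ hP s hs φ hφ hΔ u p q hu ⟨U, hU, hsub, hbdd⟩
  have hs0 : 0 < s := by linarith
  have hC0 : 0 < C' := by linarith
  -- Doubling `C' ε` turns the hypothesis into the strict inequality that the Poincaré step needs.
  have hκ : poincareConstant Ω < ENNReal.ofReal (2 * (C' * ε)) := by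
    rw [← mul_pow, ENNReal.ofReal_pow (by positivity),
      ENNReal.pow_le_pow_left_iff two_ne_zero] at hP
    refine hP.trans_lt ((ENNReal.ofReal_lt_ofReal_iff (by positivity)).2 ?_)
    have : 0 < C' * ε := by positivity
    linarith
  obtain ⟨v, hv, hv0, hv1, hv2⟩ := hu.exists_weightedTendsto hφ.continuousOn hΩ hU hsub hbdd
  simp only [sq_abs]
  set Z := weightedIntegral Ω φ fun x => u x ^ 2
  set G := weightedIntegral Ω φ fun x => ∑ i, p i x ^ 2
  set D := weightedIntegral Ω φ fun x => (∑ i, q i i x) ^ 2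
  have hZ : ∀ {c : ℝ}, c = 2 / s ∨ c = (2 * (C' * ε)) ^ 2 → Z ≤ ENNReal.ofReal (c ^ 2) * D :=
    fun hc => hv0.weightedIntegral_le hφ.continuousOn hv2 (sq_nonneg _) fun n =>
      weightedIntegral_sq_le_laplacian hφ hs0 hΔ hκ (hv n).1 (hv n).2.1 (hv n).2.2 hc
  have hGsum : G = weightedIntegral Ω φ (fun x => p 0 x ^ 2) +
      weightedIntegral Ω φ (fun x => p 1 x ^ 2) := by
    have hm : AEMeasurable (fun x => ENNReal.ofReal (Real.exp (-φ x) * p 0 x ^ 2))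
        (volume.restrict (Ω : Set Plane)) := by
      have h1 : AEMeasurable φ (volume.restrict (Ω : Set Plane)) :=
        hφ.continuousOn.aemeasurable Ω.isOpen.measurableSet
      have h2 := (hu.memLp_grad 0).1.aemeasurable
      fun_prop
    unfold G weightedIntegral
    rw [← lintegral_add_left' hm]
    congr 1 with x
    change ENNReal.ofReal (_ * ∑ i, p i x ^ 2) = _
    rw [Fin.sum_univ_two, mul_add, ENNReal.ofReal_add (by positivity) (by positivity)]
  have hG : ∀ {c : ℝ}, c = 2 / s ∨ c = (2 * (C' * ε)) ^ 2 → G ≤ ENNReal.ofReal (2 * c) * D := by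
    intro c hc
    have hc0 : 0 ≤ c := by rcases hc with rfl | rfl <;> positivity
    have key : ∀ i, weightedIntegral Ω φ (fun x => p i x ^ 2) ≤ ENNReal.ofReal c * D := fun i =>
      (hv1 i).weightedIntegral_le hφ.continuousOn hv2 hc0 fun n =>
        weightedIntegral_partialDeriv_sq_le_laplacian hφ hs0 hΔ hκ (hv n).1 (hv n).2.1
          (hv n).2.2 hc i
    rw [hGsum, two_mul, ENNReal.ofReal_add hc0 hc0, add_mul]
    exact add_le_add (key 0) (key 1)
  have scale : ∀ {a b c : ℝ} {X : ℝ≥0∞}, 0 ≤ a → X ≤ ENNReal.ofReal b * D → a * b = c →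
      ENNReal.ofReal a * X ≤ ENNReal.ofReal c * D := by
    intro a b c X ha hX habc
    rw [← habc, ENNReal.ofReal_mul ha, mul_assoc]
    exact mul_le_mul_right hX _
  rw [ENNReal.ofReal_add (by positivity) (by positivity),
    ENNReal.ofReal_add (by positivity) (by positivity),
    ENNReal.ofReal_add (by positivity) (by positivity), add_mul, add_mul, add_mul]
  refine add_le_add (add_le_add (add_le_add ?_ ?_) ?_) ?_
  · refine scale (by positivity) (hZ (Or.inr rfl)) ?_
    rw [zpow_neg]; norm_cast; field_simp; norm_num
  · refine scale (by positivity) (hZ (Or.inl rfl)) ?_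
    field_simp; norm_num
  · refine scale (by positivity) (hG (Or.inr rfl)) ?_
    rw [zpow_neg]; norm_cast; field_simp; norm_num
  · refine scale (by positivity) (hG (Or.inl rfl)) ?_
    field_simp; norm_num
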